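/- Fix an integer $t\ge 2$. A $t$-ary tree is defined recursively as being either empty, or consisting of a root node together with an ordered $t$-tuple $(T_1,\dots,T_t)$ of $t$-ary trees, any number of which may be empty. The depth of a node is the number of edges on the path from the root to it, and the path length of a nonempty tree is the sum of the depths of all its nodes, i.e. $\sum_{j\ge 1} jD_j$, where $D_j$ is the number of nodes at depth $j$. Let $T_t(p)$ denote the number of nonempty $t$-ary trees (with any number of nodes) whose path length equals $p$. Let $\log$ and $\exp$ be taken with respect to one fixed, arbitrary base $b>1$, let $h(x)=-x\log x-(1-x)\log(1-x)$ be the binary entropy function, and let $\alpha=h(t^{-1})\,t\log t$. Then, as $p\to\infty$ through the integers, $$T_t(p)=\exp\left(\frac{\alpha p}{\log p}\,\bigl(1+o(1)\bigr)\right).$$ -/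

import Mathlib

open Filter Topology

/-- A (finite) `t`-ary tree: either empty, or a root together with an ordered `t`-tuple of
`t`-ary subtrees, any number of which may be empty. -/
inductive TaryTree (t : ℕ) : Type
  | empty : TaryTree t
  | node (children : Fin t → TaryTree t) : TaryTree t

namespace TaryTree

/-- The total number of nodes of a tree. -/
def numNodes {t : ℕ} : TaryTree t → ℕ
  | empty => 0
  | node c => 1 + ∑ i, (c i).numNodes

/-- The profile of a tree: `T.profile j` is the number of nodes at depth `j`, that is, of nodes
reached from the root through exactly `j` edges. -/
def profile {t : ℕ} : TaryTree t → ℕ → ℕ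
  | empty, _ => 0
  | node _, 0 => 1
  | node c, j + 1 => ∑ i, (c i).profile j

/-- The path length of a tree: the sum of the depths of all its nodes, `∑ j, j * D_j`.
Only finitely many terms are nonzero, see `profile_eq_zero`. -/
noncomputable def pathLength {t : ℕ} (T : TaryTree t) : ℕ :=
  ∑ᶠ j : ℕ, j * T.profile j

/-- The set of nonempty `t`-ary trees with path length `p` (and any number of nodes).
It is finite, see `finite_withPathLength`. -/
def withPathLength (t p : ℕ) : Set (TaryTree t) :=
  {T | T ≠ empty ∧ T.pathLength = p}

/-- The number of `t`-ary trees with path length `p`. -/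
noncomputable def count (t p : ℕ) : ℕ :=
  (withPathLength t p).ncard

theorem profile_eq_zero {t : ℕ} (T : TaryTree t) :
    ∀ j : ℕ, T.numNodes ≤ j → T.profile j = 0 := by
  induction T with
  | empty => intro j _; simp [profile]
  | node c ih =>
    intro j hj
    cases j with
    | zero => simp [numNodes] at hj
    | succ j =>
      simp only [profile]
      refine Finset.sum_eq_zero fun i _ => ih i j ?_
      have h := Finset.single_le_sum (f := fun i => (c i).numNodes) (fun _ _ => Nat.zero_le _)
        (Finset.mem_univ i)
      simp only [numNodes] at hj
      omega

theorem pathLength_eq_sum {t : ℕ} (T : TaryTree t) :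
    T.pathLength = ∑ j ∈ Finset.range T.numNodes, j * T.profile j := by
  refine finsum_eq_sum_of_support_subset _ fun j hj => ?_
  by_contra h
  simp only [Finset.coe_range, Set.mem_Iio, not_lt] at h
  exact hj (by simp [profile_eq_zero T j h])

theorem sum_profile {t : ℕ} (T : TaryTree t) :
    ∀ M : ℕ, T.numNodes ≤ M → ∑ j ∈ Finset.range M, T.profile j = T.numNodes := by
  induction T with
  | empty => intro M _; simp [profile, numNodes]
  | node c ih =>
    intro M hM
    cases M with
    | zero => simp [numNodes] at hM
    | succ M =>
      rw [Finset.sum_range_succ']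
      simp only [profile, numNodes] at hM ⊢
      rw [Finset.sum_comm, add_comm]
      congr 1
      refine Finset.sum_congr rfl fun i _ => ih i M ?_
      have h := Finset.single_le_sum (f := fun i => (c i).numNodes) (fun _ _ => Nat.zero_le _)
        (Finset.mem_univ i)
      omega

theorem numNodes_le {t : ℕ} (T : TaryTree t) : T.numNodes ≤ T.pathLength + 1 := by
  rw [pathLength_eq_sum]
  conv_lhs => rw [← sum_profile T T.numNodes le_rfl]
  cases T with
  | empty => simp [numNodes]
  | node c =>
    have h : (node c).numNodes = (∑ i, (c i).numNodes) + 1 := by simp [numNodes, add_comm]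
    rw [h, Finset.sum_range_succ', Finset.sum_range_succ']
    simp only [zero_mul, add_zero]
    refine Nat.add_le_add (Finset.sum_le_sum fun j _ => ?_) (by simp [profile])
    exact Nat.le_mul_of_pos_left _ (Nat.succ_pos j)

theorem finite_numNodes_le (t N : ℕ) : {T : TaryTree t | T.numNodes ≤ N}.Finite := by
  induction N with
  | zero =>
    refine (Set.finite_singleton (empty : TaryTree t)).subset fun T hT => ?_
    cases T with
    | empty => rfl
    | node c => simp [numNodes] at hT
  | succ N ih =>
    refine (((Set.Finite.pi' fun _ : Fin t => ih).image node).insert empty).subset fun T hT => ?_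
    cases T with
    | empty => exact Set.mem_insert _ _
    | node c =>
      refine Set.mem_insert_of_mem _ ⟨c, fun i => ?_, rfl⟩
      have h := Finset.single_le_sum (f := fun i => (c i).numNodes) (fun _ _ => Nat.zero_le _)
        (Finset.mem_univ i)
      simp only [numNodes, Set.mem_ofPred_eq] at h hT ⊢
      omega

theorem finite_withPathLength (t p : ℕ) : (withPathLength t p).Finite :=
  (finite_numNodes_le t (p + 1)).subset fun T hT => hT.2 ▸ numNodes_le T

end TaryTree

/-- The binary entropy function, with logarithms to base `b`. -/
noncomputable def binaryEntropy (b x : ℝ) : ℝ :=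
  -x * Real.logb b x - (1 - x) * Real.logb b (1 - x)

/-! Write X for `growth t`, so log X = t·h(1/t). Trees with n nodes number about X^n, and path
length p allows at most about p / log_t p nodes; the claim is that the count is X^(p / log_t p) up
to a factor 1 + o(1) in the exponent.

Upper bound: fewer than all nodes are cheap, since depths below L hold at most t^L of them and every
other node costs at least L. With L near a·log_t p and a < 1 this gives n ≤ p/L + p^a
(`mul_numNodes_le`), and `count_le` bounds the number of such trees through the generating function
at 1/X.

Lower bound: below a complete tree of height about log_t p, put a fixed number of levels of w nodes
each. A level chooses its w places among wt in C(wt, w) ≥ X^w / (wt + 1) ways (`growth_pow_le`). For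
k free levels, kw is nearly p / log_t p once k is large, and moving r nodes down by one makes the
path length exactly p (`choose_pow_le_count`). -/

namespace TaryTree

/-! ### Path length recursion and the bound on the number of nodes -/

variable {t : ℕ}

theorem pathLength_eq_sum_of_le (T : TaryTree t) {M : ℕ} (hM : T.numNodes ≤ M) :
    T.pathLength = ∑ j ∈ Finset.range M, j * T.profile j := by
  rw [pathLength_eq_sum]
  refine Finset.sum_subset (Finset.range_mono hM) fun j _ hj => ?_
  rw [profile_eq_zero T j (by simpa using hj), mul_zero]

@[simp] theorem pathLength_empty : (empty : TaryTree t).pathLength = 0 := by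
  simp [pathLength_eq_sum, numNodes]

theorem pathLength_node (c : Fin t → TaryTree t) :
    (node c).pathLength = ∑ i, ((c i).pathLength + (c i).numNodes) := by
  have hle : ∀ i, (c i).numNodes ≤ ∑ i, (c i).numNodes := fun i =>
    Finset.single_le_sum (f := fun i => (c i).numNodes) (fun _ _ => Nat.zero_le _)
      (Finset.mem_univ i)
  rw [pathLength_eq_sum_of_le (node c) (M := (∑ i, (c i).numNodes) + 1)
    (by simp [numNodes, add_comm]), Finset.sum_range_succ']
  simp only [profile, zero_mul, add_zero, Finset.mul_sum]
  rw [Finset.sum_comm]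
  refine Finset.sum_congr rfl fun i _ => ?_
  rw [pathLength_eq_sum_of_le (c i) (hle i), ← sum_profile (c i) _ (hle i),
    ← Finset.sum_add_distrib]
  exact Finset.sum_congr rfl fun j _ => by ring

/-- At most `t ^ L` nodes have depth less than `L`. -/
theorem mul_numNodes_le (ht : 2 ≤ t) (T : TaryTree t) :
    ∀ L : ℕ, L * T.numNodes ≤ T.pathLength + L * t ^ L := by
  induction T with
  | empty => intro L; simp [numNodes]
  | node c ih =>
    intro L
    cases L with
    | zero => simp
    | succ L =>
      have h1 : ∑ i, L * (c i).numNodes ≤ ∑ i, ((c i).pathLength + L * t ^ L) :=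
        Finset.sum_le_sum fun i _ => ih i L
      -- The root adds `L + 1` to the left side; the spare `t ^ (L + 1)` absorbs it.
      have h2 : L + 1 < t ^ (L + 1) := Nat.lt_pow_self (by omega)
      rw [Finset.sum_add_distrib, ← Finset.mul_sum, Finset.sum_const, Finset.card_univ,
        Fintype.card_fin, smul_eq_mul] at h1
      rw [pathLength_node, numNodes, Finset.sum_add_distrib]
      have h3 : (L + 1) * t ^ (L + 1) = t * (L * t ^ L) + t ^ (L + 1) := by ring
      rw [h3]
      linarith

/-! ### Counting trees by nodes -/

/-- If `1 + x * A ^ t ≤ A`, then `A` bounds the generating function of `t`-ary trees at `x`. -/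
theorem sum_pow_numNodes_le {x A : ℝ} (hx : 0 ≤ x) (hA : 0 ≤ A) (h : 1 + x * A ^ t ≤ A) (N : ℕ) :
    ∀ s : Finset (TaryTree t), (∀ T ∈ s, T.numNodes ≤ N) → ∑ T ∈ s, x ^ T.numNodes ≤ A := by
  classical
  have h1 : (1 : ℝ) ≤ A := le_trans (le_add_of_nonneg_right (by positivity)) h
  induction N with
  | zero =>
    intro s hs
    have : s ⊆ {empty} := fun T hT => by
      have := hs T hT
      cases T with
      | empty => simp
      | node c => simp [numNodes] at this
    refine (Finset.sum_le_sum_of_subset_of_nonneg this fun _ _ _ => by positivity).trans ?_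
    simpa [numNodes] using h1
  | succ N ih =>
    intro s hs
    set u : Finset (TaryTree t) := (finite_numNodes_le t N).toFinset with hu
    have hsub : s ⊆ insert empty ((Fintype.piFinset fun _ : Fin t => u).image node) := by
      intro T hT
      have hT' := hs T hT
      cases T with
      | empty => simp
      | node c =>
        refine Finset.mem_insert_of_mem (Finset.mem_image_of_mem _ ?_)
        simp only [Fintype.mem_piFinset, hu, Set.Finite.mem_toFinset, Set.mem_ofPred_eq]
        intro i
        have h := Finset.single_le_sum (f := fun i => (c i).numNodes) (fun _ _ => Nat.zero_le _)
          (Finset.mem_univ i)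
        simp only [numNodes] at h hT'
        omega
    refine (Finset.sum_le_sum_of_subset_of_nonneg hsub fun _ _ _ => by positivity).trans ?_
    rw [Finset.sum_insert (by simp), Finset.sum_image (fun a _ b _ hab => by simpa using hab)]
    have h2 : ∑ c ∈ Fintype.piFinset (fun _ : Fin t => u), x ^ (node c).numNodes
        = x * (∑ T ∈ u, x ^ T.numNodes) ^ t := by
      have := Finset.prod_univ_sum (fun _ : Fin t => u) (fun _ T => x ^ T.numNodes)
      rw [Finset.prod_const, Finset.card_univ, Fintype.card_fin] at this
      rw [this, Finset.mul_sum]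
      refine Finset.sum_congr rfl fun c _ => ?_
      rw [numNodes, pow_add, pow_one, Finset.prod_pow_eq_pow_sum]
    rw [h2, numNodes, pow_zero]
    have h3 := ih u (fun T hT => by simpa [hu] using hT)
    have h4 : 0 ≤ ∑ T ∈ u, x ^ T.numNodes := Finset.sum_nonneg fun _ _ => by positivity
    refine le_trans ?_ h
    gcongr

/-- The exponential growth rate of the number of `t`-ary trees by number of nodes. -/
noncomputable def growth (t : ℕ) : ℝ := (t : ℝ) ^ t / ((t : ℝ) - 1) ^ (t - 1)

theorem one_lt_growth (ht : 2 ≤ t) : 1 < growth t := by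
  have h : (2 : ℝ) ≤ t := by exact_mod_cast ht
  have h1 : (0 : ℝ) < (t : ℝ) - 1 := by linarith
  rw [growth, one_lt_div (by positivity)]
  calc ((t : ℝ) - 1) ^ (t - 1) ≤ (t : ℝ) ^ (t - 1) := by gcongr; linarith
    _ < (t : ℝ) ^ t := pow_lt_pow_right₀ (by linarith) (by omega)

/-- At x = 1/X the equation 1 + x·A^t = A has the root A = t/(t − 1) ≤ 2, and each tree counted has
weight at least X^(−N). -/
theorem count_le (ht : 2 ≤ t) {p : ℕ} {N : ℕ}
    (hN : ∀ T : TaryTree t, T.pathLength = p → T.numNodes ≤ N) :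
    (count t p : ℝ) ≤ 2 * growth t ^ N := by
  have h : (2 : ℝ) ≤ t := by exact_mod_cast ht
  have h1 : (0 : ℝ) < (t : ℝ) - 1 := by linarith
  have hX := one_lt_growth ht
  have hX0 : 0 < growth t := by linarith
  set s := (finite_withPathLength t p).toFinset
  have hs : ∀ T ∈ s, T.numNodes ≤ N := fun T hT => hN T (by
    have : T ∈ withPathLength t p := by simpa [s] using hT
    exact this.2)
  have hA : 1 + (growth t)⁻¹ * ((t : ℝ) / (t - 1)) ^ t ≤ (t : ℝ) / (t - 1) := by
    obtain ⟨m, rfl⟩ : ∃ m, t = m + 1 := ⟨t - 1, by omega⟩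
    rw [growth]
    push_cast at h1 ⊢
    simp only [add_sub_cancel_right] at h1 ⊢
    have : (m : ℝ) ≠ 0 := h1.ne'
    apply le_of_eq
    rw [div_pow]
    field_simp
    ring
  have key := sum_pow_numNodes_le (t := t) (inv_nonneg.2 hX0.le) (by positivity) hA N s hs
  have hA2 : (t : ℝ) / (t - 1) ≤ 2 := by rw [div_le_iff₀ h1]; linarith
  have hc : (count t p : ℝ) = ∑ T ∈ s, 1 := by
    rw [count, Set.ncard_eq_toFinset_card _ (finite_withPathLength t p)]; simp [s]
  have hlow : (s.card : ℝ) * (growth t)⁻¹ ^ N ≤ ∑ T ∈ s, (growth t)⁻¹ ^ T.numNodes := by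
    rw [← nsmul_eq_mul]
    exact Finset.card_nsmul_le_sum _ _ _ fun T hT =>
      pow_le_pow_of_le_one (inv_nonneg.2 hX0.le) (inv_le_one_of_one_le₀ hX.le) (hs T hT)
  rw [hc, Finset.sum_const, nsmul_eq_mul, mul_one, ← div_le_iff₀ (by positivity), div_eq_mul_inv,
    ← inv_pow]
  linarith

/-! ### Forests built level by level -/

/-- The ordered forests of `m` possibly empty trees with `n` nodes and path length `q` in total. -/
def forests (t m n q : ℕ) : Set (Fin m → TaryTree t) :=
  {f | ∑ i, (f i).numNodes = n ∧ ∑ i, (f i).pathLength = q}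

theorem finite_forests (t m n q : ℕ) : (forests t m n q).Finite := by
  refine (Set.Finite.pi' fun _ : Fin m => finite_numNodes_le t n).subset fun f hf i => ?_
  have h := Finset.single_le_sum (f := fun i => (f i).numNodes) (fun _ _ => Nat.zero_le _)
    (Finset.mem_univ i)
  exact h.trans hf.1.le

/-- The forest with nonempty trees exactly at the places in `S`, their subtrees given by `g`. -/
noncomputable def graft {m d : ℕ} (S : Finset (Fin m)) (hS : S.card = d)
    (g : Fin (d * t) → TaryTree t) (i : Fin m) : TaryTree t :=
  if h : i ∈ S then node fun k => g (finProdFinEquiv (S.equivFinOfCardEq hS ⟨i, h⟩, k)) else empty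

theorem sum_graft {m d : ℕ} (S : Finset (Fin m)) (hS : S.card = d)
    (g : Fin (d * t) → TaryTree t) (F : TaryTree t → ℕ) (hF : F empty = 0) (a : ℕ)
    (G : TaryTree t → ℕ) (hG : ∀ c, F (node c) = a + ∑ k, G (c k)) :
    ∑ i, F (graft S hS g i) = d * a + ∑ j, G (g j) := by
  calc ∑ i, F (graft S hS g i) = ∑ i ∈ S, F (graft S hS g i) :=
        (Finset.sum_subset (Finset.subset_univ S) fun i _ h => by simp [graft, h, hF]).symm
    _ = ∑ i : S, F (graft S hS g i) := (Finset.sum_coe_sort S _).symm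
    _ = ∑ i : S, (a + ∑ k, G (g (finProdFinEquiv (S.equivFinOfCardEq hS i, k)))) :=
        Finset.sum_congr rfl fun i _ => by simp [graft, hG]
    _ = d * a + ∑ j, G (g j) := by
        rw [Finset.sum_add_distrib]
        congr 1
        · simp [hS]
        · rw [← Fintype.sum_equiv finProdFinEquiv (fun x => G (g (finProdFinEquiv x))) _
            (fun _ => rfl), Fintype.sum_prod_type]
          exact Fintype.sum_equiv (S.equivFinOfCardEq hS) _ _ fun _ => rfl

theorem graft_inj {m d : ℕ} {S S' : Finset (Fin m)} {hS : S.card = d} {hS' : S'.card = d}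
    {g g' : Fin (d * t) → TaryTree t} (h : graft S hS g = graft S' hS' g') : S = S' ∧ g = g' := by
  have hSS : S = S' := by
    ext i
    have := congrFun h i
    by_cases h1 : i ∈ S <;> by_cases h2 : i ∈ S' <;> simp_all [graft]
  subst hSS
  refine ⟨rfl, funext fun j => ?_⟩
  obtain ⟨⟨a, k⟩, rfl⟩ := finProdFinEquiv.surjective j
  obtain ⟨i, rfl⟩ := (S.equivFinOfCardEq hS).surjective a
  have := congrFun h i
  simp only [graft, i.2, dif_pos, node.injEq] at this
  exact congrFun this k

/-- Hanging a forest of d·t places under d chosen roots lowers each of its n nodes by one, hence the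
`q + n`. -/
theorem choose_mul_ncard_forests_le (t m d n q : ℕ) :
    m.choose d * (forests t (d * t) n q).ncard ≤ (forests t m (d + n) (q + n)).ncard := by
  have : Finite (forests t m (d + n) (q + n)) := finite_forests _ _ _ _
  have hmem : ∀ (S : Finset (Fin m)) (hS : S.card = d), ∀ g ∈ forests t (d * t) n q,
      graft S hS g ∈ forests t m (d + n) (q + n) := by
    rintro S hS g ⟨h1, h2⟩
    constructor
    · rw [sum_graft S hS g numNodes rfl 1 numNodes (fun c => rfl), h1, mul_one]
    · rw [sum_graft S hS g pathLength pathLength_empty 0 (fun T => T.pathLength + T.numNodes)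
        (fun c => by rw [pathLength_node, zero_add]), Finset.sum_add_distrib, h1, h2]
      simp
  have hc : m.choose d = Nat.card {S : Finset (Fin m) // S.card = d} := by
    rw [Nat.card_eq_fintype_card, Fintype.card_finset_len, Fintype.card_fin]
  rw [hc, ← Nat.card_coe_set_eq, ← Nat.card_coe_set_eq, ← Nat.card_prod]
  refine Nat.card_le_card_of_injective
    (fun x => ⟨graft x.1.1 x.1.2 x.2.1, hmem x.1.1 x.1.2 x.2.1 x.2.2⟩) ?_
  rintro ⟨⟨S, hS⟩, ⟨g, hg⟩⟩ ⟨⟨S', hS'⟩, ⟨g', hg'⟩⟩ h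
  obtain ⟨rfl, rfl⟩ := graft_inj (Subtype.ext_iff.1 h)
  rfl

theorem ncard_forests_le {m d : ℕ} (h : d ≤ m) (t n q : ℕ) :
    (forests t (d * t) n q).ncard ≤ (forests t m (d + n) (q + n)).ncard :=
  (Nat.le_mul_of_pos_left _ (Nat.choose_pos h)).trans (choose_mul_ncard_forests_le t m d n q)

theorem one_le_ncard_forests {m d : ℕ} (h : d ≤ m) (t : ℕ) : 1 ≤ (forests t m d 0).ncard := by
  have h0 : 1 ≤ (forests t (d * t) 0 0).ncard := by
    rw [Nat.one_le_iff_ne_zero, Ne, Set.ncard_eq_zero (finite_forests _ _ _ _),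
      ← Ne, ← Set.nonempty_iff_ne_empty]
    exact ⟨fun _ => empty, by simp [forests, numNodes]⟩
  exact h0.trans (ncard_forests_le h t 0 0)

/-- Forests with `k + 1` levels of `w` nodes, of which `r` last nodes are pushed one level down. -/
theorem choose_pow_le_ncard_forests {t w r : ℕ} (hr : r ≤ w) (hrt : r ≤ (w - r) * t) (ht : 1 ≤ t)
    (k : ℕ) : (w * t).choose w ^ k ≤
      (forests t (w * t) ((k + 1) * w) (r + w * ∑ i ∈ Finset.range (k + 1), i)).ncard := by
  induction k with
  | zero =>
    have := (one_le_ncard_forests hrt t).trans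
      (ncard_forests_le (m := w * t) (by nlinarith [Nat.sub_le w r]) t r 0)
    simpa [Nat.sub_add_cancel hr] using this
  | succ k ih =>
    have := choose_mul_ncard_forests_le t (w * t) w ((k + 1) * w)
      (r + w * ∑ i ∈ Finset.range (k + 1), i)
    rw [pow_succ']
    refine (Nat.mul_le_mul_left _ ih).trans (this.trans (le_of_eq ?_))
    rw [Finset.sum_range_succ _ (k + 1)]
    congr 2 <;> ring

/-- Puts L complete levels on top. Only the path length matters later, so the node count is left
existential. -/
theorem ncard_forests_pow_le (t n q L : ℕ) :
    ∃ n', (forests t (t ^ L) n q).ncard ≤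
      (forests t 1 n' (q + L * n + ∑ j ∈ Finset.range L, j * t ^ j)).ncard := by
  induction L generalizing n q with
  | zero => exact ⟨n, by simp⟩
  | succ L ih =>
    obtain ⟨n', h⟩ := ih (t ^ L + n) (q + n)
    refine ⟨n', ?_⟩
    have := ncard_forests_le (le_refl (t ^ L)) t n q
    rw [← pow_succ] at this
    refine this.trans (h.trans (le_of_eq ?_))
    rw [Finset.sum_range_succ]
    congr 2; ring

theorem ncard_forests_one_le_count {t n p : ℕ} (hp : p ≠ 0) :
    (forests t 1 n p).ncard ≤ count t p := by
  refine Set.ncard_le_ncard_of_injOn (fun f => f 0) ?_ ?_ (finite_withPathLength t p)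
  · rintro f ⟨_, h⟩
    rw [Fin.sum_univ_one] at h
    refine ⟨fun he => hp ?_, h⟩
    rw [← h, he, pathLength_empty]
  · intro f _ g _ h
    funext i
    rw [Fin.fin_one_eq_zero i]
    exact h

/-- There are `C(wt, w) ^ k` trees with full levels at depth less than `L`, then `k + 2` levels of
`w` nodes, with `r` nodes pushed from the last of these levels to the next depth. -/
theorem choose_pow_le_count {t w r L k p : ℕ} (ht : 1 ≤ t) (hr : r ≤ w) (hrt : r ≤ (w - r) * t)
    (hw : w ≤ t ^ L) (hp : p ≠ 0)
    (h : p = r + w * ∑ i ∈ Finset.range (k + 2), (L + i) + ∑ j ∈ Finset.range L, j * t ^ j) :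
    (w * t).choose w ^ k ≤ count t p := by
  obtain ⟨n', h'⟩ := ncard_forests_pow_le t (w + (k + 1) * w)
    (r + w * ∑ i ∈ Finset.range (k + 1), i + (k + 1) * w) L
  refine (choose_pow_le_ncard_forests hr hrt ht k).trans ((ncard_forests_le hw t _ _).trans
    (h'.trans ?_))
  have hp' : r + w * ∑ i ∈ Finset.range (k + 1), i + (k + 1) * w + L * (w + (k + 1) * w) +
      ∑ j ∈ Finset.range L, j * t ^ j = p := by
    rw [h, Finset.sum_add_distrib, Finset.sum_const, Finset.card_range,
      Finset.sum_range_succ _ (k + 1)]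
    simp only [smul_eq_mul]
    congr 1
    ring
  rw [hp']
  exact ncard_forests_one_le_count hp

/-! ### Binomial coefficients against the growth rate -/

/-- Expand (1 + (t − 1))^(wt): of its wt + 1 terms the one at j = w is the largest, by the ratio of
consecutive terms. -/
theorem pow_le_mul_choose {t : ℕ} (ht : 2 ≤ t) (w : ℕ) :
    t ^ (w * t) ≤ (w * t + 1) * ((w * t).choose w * (t - 1) ^ (w * t - w)) := by
  obtain ⟨s, rfl⟩ : ∃ s, t = s + 1 := ⟨t - 1, by omega⟩
  have hs : 0 < s := by omega
  set n := w * (s + 1) with hn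
  have hwn : w ≤ n := by rw [hn]; exact Nat.le_mul_of_pos_right _ (by omega)
  set T : ℕ → ℕ := fun j => n.choose j * s ^ (n - j) with hT
  have hstep : ∀ j, j < n → (j + 1) * s * T (j + 1) = (n - j) * T j := by
    intro j hj
    have h1 := Nat.choose_succ_right_eq n j
    have h2 : s ^ (n - j) = s * s ^ (n - (j + 1)) := by rw [← pow_succ']; congr 1; omega
    simp only [hT]
    calc (j + 1) * s * (n.choose (j + 1) * s ^ (n - (j + 1)))
        = (n.choose (j + 1) * (j + 1)) * (s * s ^ (n - (j + 1))) := by ring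
      _ = _ := by rw [h1, ← h2]; ring
  have hmax : ∀ j, j ≤ n → T j ≤ T w := by
    intro j hj
    rcases le_total j w with hjw | hjw
    · refine Nat.decreasingInduction' (P := fun j => T j ≤ T w) (fun i hi _ ih => ?_) hjw le_rfl
      refine le_trans (Nat.le_of_mul_le_mul_left (c := (i + 1) * s) ?_ (by positivity)) ih
      rw [hstep i (by omega)]
      refine Nat.mul_le_mul_right _ (Nat.le_sub_of_add_le ?_)
      nlinarith
    · induction j, hjw using Nat.le_induction with
      | base => exact le_rfl
      | succ i hi ih =>
        refine le_trans (Nat.le_of_mul_le_mul_left (c := (i + 1) * s) ?_ (by positivity))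
          (ih (by omega))
        rw [hstep i (by omega)]
        refine Nat.mul_le_mul_right _ (Nat.sub_le_iff_le_add.2 ?_)
        nlinarith
  have : (s + 1) ^ n = ∑ j ∈ Finset.range (n + 1), T j := by
    rw [add_comm, add_pow]
    exact Finset.sum_congr rfl fun j _ => by simp [hT, mul_comm]
  rw [this, Nat.add_sub_cancel]
  refine (Finset.sum_le_card_nsmul _ _ (T w) fun j hj => hmax j ?_).trans (by simp [hT])
  simpa [Nat.lt_succ_iff] using hj

theorem growth_pow_le {t : ℕ} (ht : 2 ≤ t) (w : ℕ) :
    growth t ^ w ≤ (w * t + 1) * (w * t).choose w := by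
  have h := pow_le_mul_choose ht w
  have ht' : (2 : ℝ) ≤ t := by exact_mod_cast ht
  have h1 : (0 : ℝ) < (t : ℝ) - 1 := by linarith
  have h' : (t : ℝ) ^ (w * t) ≤ (w * t + 1) * ((w * t).choose w * ((t : ℝ) - 1) ^ (w * t - w)) := by
    have := (Nat.cast_le (α := ℝ)).2 h
    push_cast [Nat.cast_sub (show 1 ≤ t by omega)] at this
    exact this
  rw [growth, div_pow, div_le_iff₀ (by positivity), ← pow_mul, ← pow_mul, mul_comm t w, mul_assoc]
  have e : (t - 1) * w = w * t - w := by rw [Nat.sub_mul, one_mul, mul_comm]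
  rwa [e]

/-! ### Fitting the construction to an exact path length -/

theorem sum_mul_pow_le {t : ℕ} (ht : 2 ≤ t) (L : ℕ) :
    ∑ j ∈ Finset.range L, j * t ^ j ≤ L * t ^ L := by
  induction L with
  | zero => simp
  | succ L ih =>
    rw [Finset.sum_range_succ]
    calc _ ≤ L * t ^ L + L * t ^ L := by gcongr
      _ = L * t ^ L * 2 := by ring
      _ ≤ (L + 1) * t ^ L * t := by gcongr; omega
      _ = (L + 1) * t ^ (L + 1) := by ring

theorem eventually_sq_le_mul_pow {t : ℕ} (ht : 2 ≤ t) {e : ℝ} (he : 0 < e) :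
    ∀ᶠ m : ℕ in atTop, (m : ℝ) ^ 2 ≤ e * (t : ℝ) ^ m := by
  have h1 : (1 : ℝ) < t := by exact_mod_cast ht
  filter_upwards [(tendsto_pow_const_div_const_pow_of_one_lt 2 h1).eventually_le_const he]
    with m hm
  rwa [div_le_iff₀ (by positivity)] at hm

/-- Every large `p` lies between consecutive values of a sequence at an arbitrarily large index. -/
theorem eventually_exists_between {f : ℕ → ℕ} (hf : Tendsto f atTop atTop) {P : ℕ → Prop}
    (hP : ∀ᶠ m in atTop, P m) : ∀ᶠ p in atTop, ∃ m, P m ∧ f m ≤ p ∧ p < f (m + 1) := by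
  obtain ⟨M, hM⟩ := eventually_atTop.1 hP
  filter_upwards [eventually_ge_atTop (∑ j ∈ Finset.range (M + 1), f j)] with p hp
  have hle : ∀ j ≤ M, f j ≤ p := fun j hj =>
    (Finset.single_le_sum (f := f) (fun _ _ => Nat.zero_le _) (by simp; omega)).trans hp
  have hex : ∃ L, p < f L := (hf.eventually_gt_atTop p).exists
  classical
  have hlt : M < Nat.find hex := by
    by_contra h
    exact absurd (Nat.find_spec hex) (not_lt.2 (hle _ (not_lt.1 h)))
  refine ⟨Nat.find hex - 1, hM _ (by omega), not_lt.1 (Nat.find_min hex (by omega)), ?_⟩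
  rw [Nat.sub_add_cancel (by omega)]
  exact Nat.find_spec hex

/-- The term 2t/(k + 2) bounds the share of p spent on the complete levels; the strict inequality
leaves room for rounding. -/
theorem eventually_exists_choose_pow_le_count {t : ℕ} (ht : 2 ≤ t) {k : ℕ} {c : ℝ} (hc : 0 < c)
    (hck : c * (k + 2) < 1 - 2 * t / (k + 2)) :
    ∀ᶠ p : ℕ in atTop, ∃ w : ℕ, c * (p / Real.logb t p) ≤ w ∧
      (w * t).choose w ^ k ≤ count t p := by
  have ht1 : (1 : ℝ) < t := by exact_mod_cast ht
  obtain ⟨γ, hγ1, hγ2⟩ := exists_between hck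
  have hγ0 : 0 < γ := lt_trans (by positivity) hγ1
  set B : ℕ → ℕ := fun L => ∑ i ∈ Finset.range (k + 2), (L + i) with hB
  have hBlow : ∀ L, (k + 2) * L ≤ B L := fun L => by
    have := Finset.card_nsmul_le_sum (Finset.range (k + 2)) (fun i => L + i) L
      (fun i _ => Nat.le_add_right _ _)
    simpa [hB] using this
  have hBup : ∀ m, B (m + 1) ≤ (k + 2) * (m + (k + 2)) := fun m => by
    have := Finset.sum_le_card_nsmul (Finset.range (k + 2)) (fun i => m + 1 + i) (m + (k + 2))
      (fun i hi => by have := Finset.mem_range.1 hi; omega)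
    simpa [hB] using this
  -- `B L` is the cost per unit of width of k + 2 levels starting at depth L. Taking p between
  -- consecutive values of `t ^ L * B L` will force w ≤ t^(m+1).
  have hf : Tendsto (fun L => t ^ L * B L) atTop atTop := by
    refine tendsto_atTop_mono (fun L => ?_) tendsto_id
    calc L ≤ (k + 2) * L := Nat.le_mul_of_pos_left _ (by omega)
      _ ≤ B L := hBlow L
      _ ≤ t ^ L * B L := Nat.le_mul_of_pos_left _ (by positivity)
  have hlin : ∀ᶠ m : ℕ in atTop, c * (k + 2) * (k + 2) ≤ (γ - c * (k + 2)) * m :=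
    (tendsto_natCast_atTop_atTop.const_mul_atTop (sub_pos.2 hγ1)).eventually_ge_atTop _
  have hk : (0 : ℝ) < 4 * (k + 2) := by positivity
  filter_upwards [eventually_exists_between hf (hlin.and ((eventually_ge_atTop (k + 2)).and
    ((eventually_sq_le_mul_pow ht (div_pos (sub_pos.2 hγ2) hk)).and
      (eventually_sq_le_mul_pow ht (div_pos hc hk)))))]
    with p ⟨m, ⟨h1, h2, h3, h4⟩, h5, h6⟩
  have hm1 : 1 ≤ m := by omega
  have hpm : t ^ m ≤ p := (Nat.le_mul_of_pos_right _
    (lt_of_lt_of_le (by positivity) (hBlow m))).trans h5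
  have hpmR : (t : ℝ) ^ m ≤ p := by exact_mod_cast hpm
  have hp0 : 0 < p := lt_of_lt_of_le (by positivity) hpm
  set A := ∑ j ∈ Finset.range (m + 1), j * t ^ j with hA
  have hAk : (k + 2) * A ≤ 2 * t * p := by
    calc (k + 2) * A ≤ (k + 2) * ((m + 1) * t ^ (m + 1)) := by gcongr; exact sum_mul_pow_le ht _
      _ ≤ (k + 2) * ((2 * m) * t ^ (m + 1)) := by gcongr; omega
      _ = 2 * t * (t ^ m * ((k + 2) * m)) := by ring
      _ ≤ 2 * t * (t ^ m * B m) := by gcongr; exact hBlow m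
      _ ≤ 2 * t * p := by gcongr
  have hAR : (A : ℝ) ≤ 2 * t / (k + 2) * p := by
    rw [div_mul_eq_mul_div, le_div_iff₀ (by positivity), mul_comm]
    exact_mod_cast hAk
  have hp0R : (0 : ℝ) < p := by exact_mod_cast hp0
  have hAp : A ≤ p := by
    have : (A : ℝ) ≤ p := by nlinarith
    exact_mod_cast this
  have hmR : (1 : ℝ) ≤ m := by exact_mod_cast hm1
  have hkm : (k + 2 : ℝ) ≤ m := by exact_mod_cast h2
  have hBR : (B (m + 1) : ℝ) ≤ (k + 2) * (m + (k + 2)) := by exact_mod_cast hBup m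
  set b := B (m + 1) with hb
  have hb0 : 0 < b := lt_of_lt_of_le (by positivity) (hBlow (m + 1))
  have hbR : (0 : ℝ) < b := by exact_mod_cast hb0
  set w := (p - A) / b with hw
  set r := (p - A) % b with hr
  have hrb : r < b := Nat.mod_lt _ hb0
  have hdiv : b * w + r = p - A := Nat.div_add_mod _ _
  have hdivR : (b : ℝ) * w + r = p - A := by
    rw [← Nat.cast_sub hAp, ← hdiv]; push_cast; ring
  have hrbR : (r : ℝ) < b := by exact_mod_cast hrb
  have hb2 : (b : ℝ) ≤ 4 * (k + 2) * (m : ℝ) ^ 2 := by nlinarith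
  -- b is linear in m while p ≥ t^m, so the remainder r < b is negligible; this form yields `2 * b ≤
  -- w`, hence r ≤ w − r.
  have hb3 : 2 * (b : ℝ) * m ≤ 4 * (k + 2) * (m : ℝ) ^ 2 := by nlinarith
  rw [div_mul_eq_mul_div, le_div_iff₀ hk, mul_comm] at h3 h4
  have hbp : (b : ℝ) ≤ (1 - 2 * t / (k + 2) - γ) * p :=
    hb2.trans (h3.trans (mul_le_mul_of_nonneg_left hpmR (sub_pos.2 hγ2).le))
  have hwb : γ * p ≤ w * b := by nlinarith
  have hcb : c * b ≤ γ * m := by nlinarith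
  have hwm : c * p ≤ w * m := by
    refine le_of_mul_le_mul_left ?_ hγ0
    calc γ * (c * p) = c * (γ * p) := by ring
      _ ≤ c * (w * b) := by gcongr
      _ = w * (c * b) := by ring
      _ ≤ w * (γ * m) := by gcongr
      _ = γ * (w * m) := by ring
  have hlog : (m : ℝ) ≤ Real.logb t p := by
    rw [Real.le_logb_iff_rpow_le ht1 hp0R, Real.rpow_natCast]
    exact hpmR
  have h2b : 2 * b ≤ w := by
    have : 2 * (b : ℝ) * m ≤ w * m :=
      hb3.trans (h4.trans ((mul_le_mul_of_nonneg_left hpmR hc.le).trans hwm))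
    have := le_of_mul_le_mul_right this (by linarith)
    exact_mod_cast this
  refine ⟨w, ?_, choose_pow_le_count (r := r) (L := m + 1) (by omega) (by omega) ?_ ?_ hp0.ne' ?_⟩
  · rw [← mul_div_assoc, div_le_iff₀ (by linarith)]
    exact hwm.trans (by gcongr)
  · calc r ≤ w - r := by omega
      _ ≤ (w - r) * t := Nat.le_mul_of_pos_right _ (by omega)
  · have : b * w < b * t ^ (m + 1) := by
      rw [mul_comm b (t ^ (m + 1))]; omega
    exact (lt_of_mul_lt_mul_left this (Nat.zero_le _)).le
  · change p = r + w * b + A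
    rw [mul_comm w b]; omega

/-! ### Logarithmic asymptotics -/

theorem tendsto_natCast_div_logb {t : ℕ} (ht : 2 ≤ t) :
    Tendsto (fun p : ℕ => (p : ℝ) / Real.logb t p) atTop atTop := by
  have ht1 : (1 : ℝ) < t := by exact_mod_cast ht
  have h : Tendsto (fun x : ℝ => Real.log x / x) atTop (𝓝[>] 0) := by
    refine tendsto_nhdsWithin_iff.2 ⟨?_, ?_⟩
    · simpa using Real.isLittleO_log_id_atTop.tendsto_div_nhds_zero
    · filter_upwards [eventually_gt_atTop 1] with x hx
      exact div_pos (Real.log_pos hx) (by linarith)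
  refine ((h.inv_tendsto_nhdsGT_zero.const_mul_atTop (Real.log_pos ht1)).comp
    tendsto_natCast_atTop_atTop).congr fun p => ?_
  simp only [Function.comp, Pi.inv_apply, Real.logb, inv_div]
  rw [div_div_eq_mul_div]; ring

theorem eventually_log_count_le {t : ℕ} (ht : 2 ≤ t) {δ : ℝ} (hδ : 0 < δ) :
    ∀ᶠ p : ℕ in atTop,
      Real.log (count t p) ≤ (1 + δ) * (Real.log (growth t) * (p / Real.logb t p)) := by
  have ht1 : (1 : ℝ) < t := by exact_mod_cast ht
  have hX := one_lt_growth ht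
  have hlX := Real.log_pos hX
  obtain ⟨a, ha0, ha1, haδ⟩ : ∃ a : ℝ, 0 < a ∧ a < 1 ∧ a⁻¹ < 1 + δ := by
    refine ⟨(1 + δ / 2)⁻¹, by positivity, inv_lt_one_of_one_lt₀ (by linarith), ?_⟩
    rw [inv_inv]; linarith
  set g : ℕ → ℝ := fun p => p / Real.logb t p with hg
  have hgt : Tendsto g atTop atTop := tendsto_natCast_div_logb ht
  have hlt : Tendsto (fun p : ℕ => Real.logb t p) atTop atTop :=
    (Real.tendsto_logb_atTop ht1).comp tendsto_natCast_atTop_atTop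
  set L : ℕ → ℕ := fun p => ⌊a * Real.logb t p⌋₊ with hL
  have hLt : Tendsto L atTop atTop :=
    tendsto_nat_floor_atTop.comp (hlt.const_mul_atTop ha0)
  have hlim1 : Tendsto (fun p => Real.log 2 / Real.log (growth t) / g p) atTop (𝓝 0) :=
    hgt.const_div_atTop _
  have hlim2 : Tendsto (fun p : ℕ => (L p / Real.logb t p)⁻¹) atTop (𝓝 a⁻¹) :=
    ((tendsto_nat_floor_mul_div_atTop ha0.le).comp hlt).inv₀ ha0.ne'
  have hlim3 : Tendsto (fun p : ℕ => (p : ℝ) ^ a / g p) atTop (𝓝 0) := by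
    have h := (((isLittleO_log_rpow_atTop (sub_pos.2 ha1)).tendsto_div_nhds_zero).div_const
      (Real.log t)).comp tendsto_natCast_atTop_atTop (α := ℕ)
    rw [zero_div] at h
    refine h.congr' ?_
    filter_upwards [eventually_gt_atTop 0] with p hp
    have hp' : (0 : ℝ) < p := by exact_mod_cast hp
    simp only [Function.comp, hg, Real.logb]
    rw [Real.rpow_sub hp', Real.rpow_one]
    have := (Real.rpow_pos_of_pos hp' a).ne'
    field_simp
  have hlim := (hlim1.add hlim2).add hlim3
  rw [zero_add, add_zero] at hlim
  filter_upwards [hlim.eventually_le_const haδ, hgt.eventually_gt_atTop 0,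
    hLt.eventually_ge_atTop 1, hlt.eventually_gt_atTop 0, eventually_gt_atTop 0]
    with p h1 h2 h3 h4 h5
  have hp' : (0 : ℝ) < p := by exact_mod_cast h5
  have hL0 : (0 : ℝ) < L p := by exact_mod_cast h3
  have hcount : (count t p : ℝ) ≤ 2 * growth t ^ (p / L p + t ^ L p) := by
    refine count_le ht fun T hT => ?_
    rw [← Nat.sub_le_iff_le_add, Nat.le_div_iff_mul_le h3, Nat.sub_mul]
    have := mul_numNodes_le ht T (L p)
    rw [hT] at this
    rw [mul_comm T.numNodes, mul_comm (t ^ L p)]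
    omega
  have hpow : (t : ℝ) ^ L p ≤ (p : ℝ) ^ a := by
    rw [← Real.rpow_natCast]
    calc (t : ℝ) ^ (L p : ℝ) ≤ (t : ℝ) ^ (Real.logb t p * a) :=
          Real.rpow_le_rpow_of_exponent_le ht1.le
            ((Nat.floor_le (by positivity)).trans (mul_comm _ _).le)
      _ = (p : ℝ) ^ a := by
          rw [Real.rpow_mul (by linarith), Real.rpow_logb (by linarith) ht1.ne' hp']
  -- A zero count is harmless because `Real.log 0 = 0`.
  rcases Nat.eq_zero_or_pos (count t p) with h0 | h0
  · rw [h0, Nat.cast_zero, Real.log_zero]; positivity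
  calc Real.log (count t p) ≤ Real.log (2 * growth t ^ (p / L p + t ^ L p)) :=
        Real.log_le_log (by exact_mod_cast h0) hcount
    _ = Real.log 2 + ((p / L p : ℕ) + (t : ℝ) ^ L p) * Real.log (growth t) := by
        rw [Real.log_mul (by norm_num) (by positivity), Real.log_pow]; push_cast; rfl
    _ ≤ Real.log 2 + (p / L p + (p : ℝ) ^ a) * Real.log (growth t) := by
        gcongr; exact Nat.cast_div_le
    _ = (Real.log 2 / Real.log (growth t) / g p + (L p / Real.logb t p)⁻¹ + (p : ℝ) ^ a / g p) *
          (Real.log (growth t) * g p) := by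
        have e : (p : ℝ) = g p * Real.logb t p := by rw [hg]; field_simp
        have e2 : (L p / Real.logb t p)⁻¹ = p / L p / g p := by
          rw [inv_div, eq_div_iff h2.ne', div_mul_eq_mul_div, mul_comm, ← e]
        rw [e2]
        field_simp
        ring
    _ ≤ _ := by gcongr

theorem eventually_le_log_count {t : ℕ} (ht : 2 ≤ t) {δ : ℝ} (hδ : 0 < δ) :
    ∀ᶠ p : ℕ in atTop, 0 < count t p ∧
      (1 - δ) * (Real.log (growth t) * (p / Real.logb t p)) ≤ Real.log (count t p) := by
  wlog hδ1 : δ < 1 generalizing δ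
  · have h2 : (1 : ℝ) / 2 < 1 := by norm_num
    filter_upwards [this (by norm_num) h2, (tendsto_natCast_div_logb ht).eventually_gt_atTop 0]
      with p ⟨h0, hp⟩ hg
    have := mul_pos (Real.log_pos (one_lt_growth ht)) hg
    exact ⟨h0, le_trans (by gcongr; linarith) hp⟩
  have ht1 : (1 : ℝ) < t := by exact_mod_cast ht
  have hlX := Real.log_pos (one_lt_growth ht)
  have hu : Tendsto (fun k : ℕ => ((k : ℝ) + 2)⁻¹) atTop (𝓝 0) :=
    (tendsto_atTop_add_const_right _ _ tendsto_natCast_atTop_atTop).inv_tendsto_atTop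
  have hv : Tendsto (fun k : ℕ => (1 - 2 * ((k : ℝ) + 2)⁻¹) *
      (1 - (2 * t + 1) * ((k : ℝ) + 2)⁻¹)) atTop (𝓝 1) := by
    have := ((hu.const_mul 2).const_sub 1).mul ((hu.const_mul (2 * (t : ℝ) + 1)).const_sub 1)
    simpa using this
  have hv' : Tendsto (fun k : ℕ => 1 - (2 * t + 1) * ((k : ℝ) + 2)⁻¹) atTop (𝓝 1) := by
    simpa using (hu.const_mul (2 * (t : ℝ) + 1)).const_sub 1
  obtain ⟨k, hk1, hk2⟩ := ((hv.eventually_const_le (show 1 - δ / 2 < 1 by linarith)).and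
    (hv'.eventually_const_lt zero_lt_one)).exists
  -- With u = 1/(k + 2), c(k + 2) = 1 − (2t + 1)u lies just below the allowed 1 − 2tu, and kc still
  -- tends to 1.
  set c : ℝ := (1 - (2 * t + 1) * ((k : ℝ) + 2)⁻¹) * ((k : ℝ) + 2)⁻¹ with hc
  have hk0 : (0 : ℝ) < (k : ℝ) + 2 := by positivity
  have hc0 : 0 < c := mul_pos hk2 (inv_pos.2 hk0)
  have hkc : 1 - δ / 2 ≤ k * c := by
    refine hk1.trans (le_of_eq ?_)
    rw [hc]; field_simp; ring
  have hck : c * (k + 2) < 1 - 2 * t / (k + 2) := by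
    rw [hc, inv_mul_cancel_right₀ hk0.ne', div_eq_mul_inv]
    have := inv_pos.2 hk0
    linarith
  have hlog : ∀ᶠ w : ℕ in atTop,
      Real.log (w * t + 1) ≤ δ / 2 * (w * Real.log (growth t)) := by
    have h1 : Tendsto (fun w : ℕ => (w : ℝ) * t + 1) atTop atTop :=
      tendsto_atTop_add_const_right _ _ (tendsto_natCast_atTop_atTop.atTop_mul_const (by linarith))
    have hη : 0 < δ / 2 * Real.log (growth t) / (t + 1) := by positivity
    filter_upwards [h1.eventually (Real.isLittleO_log_id_atTop.bound hη), eventually_ge_atTop 1]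
      with w hw hw1
    have hw1' : (1 : ℝ) ≤ w := by exact_mod_cast hw1
    rw [id, Real.norm_eq_abs, Real.norm_eq_abs, abs_of_nonneg (by positivity : (0:ℝ) ≤ w * t + 1)]
      at hw
    refine (le_abs_self _).trans (hw.trans ?_)
    rw [div_mul_eq_mul_div, div_le_iff₀ (by positivity)]
    have : (w : ℝ) * t + 1 ≤ w * (t + 1) := by nlinarith
    calc _ ≤ δ / 2 * Real.log (growth t) * (w * (t + 1)) := by gcongr
      _ = _ := by ring
  obtain ⟨W, hW⟩ := eventually_atTop.1 hlog
  filter_upwards [eventually_exists_choose_pow_le_count ht hc0 hck,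
    ((tendsto_natCast_div_logb ht).const_mul_atTop hc0).eventually_ge_atTop (W : ℝ),
    (tendsto_natCast_div_logb ht).eventually_gt_atTop 0] with p ⟨w, hw1, hw2⟩ hpW hg
  have hch : 0 < (w * t).choose w := Nat.choose_pos (Nat.le_mul_of_pos_right _ (by omega))
  have hchR : (0 : ℝ) < (w * t).choose w := by exact_mod_cast hch
  have hpos : 0 < count t p := lt_of_lt_of_le (by positivity) hw2
  refine ⟨hpos, ?_⟩
  have hWw : W ≤ w := by exact_mod_cast hpW.trans hw1
  have h1 := hW w hWw
  have h2 : w * Real.log (growth t) ≤ Real.log (w * t + 1) + Real.log ((w * t).choose w) := by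
    rw [← Real.log_mul (by positivity) hchR.ne', ← Real.log_pow]
    exact Real.log_le_log (pow_pos (by linarith [one_lt_growth ht]) _) (growth_pow_le ht w)
  have h3 : k * Real.log ((w * t).choose w) ≤ Real.log (count t p) := by
    rw [← Real.log_pow]
    exact Real.log_le_log (by positivity) (by exact_mod_cast hw2)
  set g := (p : ℝ) / Real.logb t p with hgdef
  -- One factor 1 − δ/2 pays for kc < 1, the other for the polynomial loss wt + 1.
  calc (1 - δ) * (Real.log (growth t) * g)
      ≤ ((1 - δ / 2) * (1 - δ / 2)) * (Real.log (growth t) * g) := by gcongr; nlinarith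
    _ ≤ (k * c * (1 - δ / 2)) * (Real.log (growth t) * g) := by gcongr; linarith
    _ = k * ((1 - δ / 2) * ((c * g) * Real.log (growth t))) := by ring
    _ ≤ k * ((1 - δ / 2) * (w * Real.log (growth t))) := by gcongr; linarith
    _ ≤ k * Real.log ((w * t).choose w) := by gcongr; linarith
    _ ≤ _ := h3

theorem tendsto_log_count_div {t : ℕ} (ht : 2 ≤ t) :
    Tendsto (fun p : ℕ => Real.log (count t p) / (Real.log (growth t) * (p / Real.logb t p)))
      atTop (𝓝 1) := by
  rw [Metric.tendsto_nhds]
  intro δ hδ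
  filter_upwards [eventually_log_count_le ht (half_pos hδ), eventually_le_log_count ht (half_pos hδ),
    (tendsto_natCast_div_logb ht).eventually_gt_atTop 0] with p h1 h2 hg
  have h0 := mul_pos (Real.log_pos (one_lt_growth ht)) hg
  rw [Real.dist_eq, abs_lt]
  have h1' := (div_le_iff₀ h0).2 h1
  have h2' := (le_div_iff₀ h0).2 h2.2
  constructor <;> linarith

/-- Identifies the rate found by counting with the entropy constant. -/
theorem logb_growth {t : ℕ} (ht : 2 ≤ t) (b : ℝ) :
    Real.logb b (growth t) = binaryEntropy b ((t : ℝ)⁻¹) * t := by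
  have ht1 : (1 : ℝ) < t := by exact_mod_cast ht
  have h1 : (0 : ℝ) < (t : ℝ) - 1 := by linarith
  have e : 1 - (t : ℝ)⁻¹ = (t - 1) / t := by field_simp
  rw [binaryEntropy, e, growth, Real.logb_div (by positivity) (by positivity),
    Real.logb_div h1.ne' (by positivity), Real.logb_pow, Real.logb_pow, Real.logb_inv,
    Nat.cast_sub (by omega), Nat.cast_one]
  field_simp
  ring

end TaryTree

theorem theorem1 (t : ℕ) (ht : 2 ≤ t) (b : ℝ) (hb : 1 < b) (α : ℝ)
    (hα : α = binaryEntropy b ((t : ℝ)⁻¹) * t * Real.logb b t) :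
    ∃ ε : ℕ → ℝ, Tendsto ε atTop (𝓝 0) ∧
      ∀ᶠ p : ℕ in atTop,
        (TaryTree.count t p : ℝ) = b ^ (α * p / Real.logb b p * (1 + ε p)) := by
  have hlim := (TaryTree.tendsto_log_count_div ht).sub_const 1
  rw [sub_self] at hlim
  refine ⟨_, hlim, ?_⟩
  filter_upwards [TaryTree.eventually_le_log_count ht one_pos,
    (TaryTree.tendsto_natCast_div_logb ht).eventually_gt_atTop 0, eventually_gt_atTop 1]
    with p h hg hp
  have hlX := Real.log_pos (TaryTree.one_lt_growth ht)
  have hlb := Real.log_pos hb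
  have hlt : 0 < Real.log t := Real.log_pos (by exact_mod_cast ht)
  have hlp : 0 < Real.log p := Real.log_pos (by exact_mod_cast hp)
  have hp0 : (0 : ℝ) < p := by positivity
  have hexp : α * p / Real.logb b p * (1 + (Real.log (TaryTree.count t p) /
      (Real.log (TaryTree.growth t) * (p / Real.logb t p)) - 1)) =
      Real.logb b (TaryTree.count t p) := by
    -- The factor log_b t in α turns p / log_b p into p / log_t p, so the base cancels.
    rw [hα, ← TaryTree.logb_growth ht, add_sub_cancel]
    simp only [Real.logb]
    field_simp
  rw [hexp, Real.rpow_logb (by linarith) hb.ne' (by exact_mod_cast h.1)]
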